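/- Let $k\ge 1$ be an integer and let $T$ be a finite tree of order $n$. Write $d(v)$ for the degree of a vertex $v$ of $T$, and put $$\Pi_1(T)=\prod_{v\in V(T)}d(v)^2,\qquad \Pi_2(T)=\prod_{uv\in E(T)}d(u)\,d(v).$$ Let $\gamma_k=\gamma_k(T)$ be the distance $k$-domination number of $T$, i.e. the minimum cardinality of a set $D\subseteq V(T)$ such that every vertex outside $D$ is at distance at most $k$ from some vertex of $D$. For integers $s\ge 1$ and $n\ge (k+1)s$, let $T_{n,k,s}$ be the tree on $n$ vertices obtained by attaching to a central vertex one pendent path of length $k$, $s-1$ pendent paths of length $k+1$, and $n-(k+1)s$ pendent edges (the length of a pendent path is the number of its edges, including the edge at the centre); the centre then has degree $n-ks$. Suppose $\gamma_k\ge 3$. Then $n\ge (k+1)\gamma_k$ (so $T_{n,k,\gamma_k}$ is defined), $$\Pi_1(T)\ \ge\ 4^{k\gamma_k-1}(n-k\gamma_k)^2\qquad\text{and}\qquad \Pi_2(T)\ \le\ 4^{k\gamma_k-1}(n-k\gamma_k)^{\,n-k\gamma_k}.$$ Moreover, equality holds in the first inequality if and only if $T\cong T_{n,k,\gamma_k}$,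 and equality holds in the second inequality if and only if $T\cong T_{n,k,\gamma_k}$. -/

import Mathlib

namespace SimpleGraph

/-- The first multiplicative Zagreb index: the product of the squared vertex degrees. -/
def zagrebPiOne {V : Type*} [Fintype V] (G : SimpleGraph V) [DecidableRel G.Adj] : ℕ :=
  ∏ v : V, G.degree v ^ 2

/-- The second multiplicative Zagreb index: the product over all edges `uv` of `d(u) d(v)`. -/
def zagrebPiTwo {V : Type*} [Fintype V] [DecidableEq V] (G : SimpleGraph V)
    [DecidableRel G.Adj] : ℕ :=
  ∏ e ∈ G.edgeFinset, (e.map fun v => G.degree v).mul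

/-- `D` is a distance `k`-dominating set of `G`: every vertex outside `D` is at distance at most
`k` from some vertex of `D`. The extended distance is used, so that vertices in different
components are never within distance `k`. -/
def IsDistDominating {V : Type*} (G : SimpleGraph V) (k : ℕ) (D : Finset V) : Prop :=
  ∀ u : V, u ∉ D → ∃ v ∈ D, G.edist u v ≤ (k : ℕ∞)

/-- The distance `k`-domination number: the minimum cardinality of a distance `k`-dominating set
(the whole vertex set is one, so the minimum is over a nonempty set). -/
noncomputable def distDominationNumber {V : Type*} [Fintype V] (G : SimpleGraph V) (k : ℕ) : ℕ :=
  sInf {m : ℕ | ∃ D : Finset V, G.IsDistDominating k D ∧ D.card = m}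

/-- One orientation of the adjacency in a starlike tree: `none` is the centre and `some ⟨i, j⟩` is
the vertex at distance `j + 1` from the centre on the `i`-th leg. -/
def starlikeRel {ι : Type*} (len : ι → ℕ) :
    Option (Σ i, Fin (len i)) → Option (Σ i, Fin (len i)) → Prop
  | none, some y => y.2.val = 0
  | some x, some y => x.1 = y.1 ∧ x.2.val + 1 = y.2.val
  | _, none => False

/-- The starlike tree obtained by attaching to a centre, for each index `i`, a pendent path of
length `len i`. -/
def starlike {ι : Type*} (len : ι → ℕ) : SimpleGraph (Option (Σ i, Fin (len i))) :=
  SimpleGraph.fromRel (starlikeRel len)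

/-- The lengths of the pendent paths at the centre of `T_{n,k,s}`: one path of length `k`,
`s - 1` paths of length `k + 1`, and `n - (k + 1) s` paths of length `1`. -/
def zagrebLegs (n k s : ℕ) : Fin 1 ⊕ Fin (s - 1) ⊕ Fin (n - (k + 1) * s) → ℕ
  | Sum.inl _ => k
  | Sum.inr (Sum.inl _) => k + 1
  | Sum.inr (Sum.inr _) => 1

/-- The tree `T_{n,k,s}`, meant for `s ≥ 1` and `n ≥ (k + 1) s`: it then has `n` vertices and its
centre has degree `n - k s`. -/
def zagrebTree (n k s : ℕ) : SimpleGraph (Option (Σ i, Fin (zagrebLegs n k s i))) :=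
  starlike (zagrebLegs n k s)

end SimpleGraph

/-!
Grouping the factors by vertices gives `Π₂(T) = ∏ d(v) ^ d(v)`, so `-log Π₁(T)` and `log Π₂(T)`
are, up to a positive factor, sums `∑ f (d(v))` with `f` strictly convex on `[1, ∞)`.

Let `r` be a vertex farthest from some vertex `x`. The vertices whose distance from `r` lies in a
fixed class modulo `k + 1` form a distance `k`-dominating set, so the smallest class gives
`(k + 1) γ_k ≤ n`. The subtree of non-leaves has distance `(k - 1)`-domination number at least
`γ_k`, hence at least `k γ_k` vertices. The degrees sum to `2 (n - 1)`, so by convexity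
`∑ f (d(v))` is at most its value when `n - k γ_k` vertices are leaves and all but one of the other
vertices have degree two. Equality forces exactly this degree sequence, so `T` is a starlike tree
with `n - k γ_k` legs.

It remains to determine the leg lengths. The numbers `m = length - 1`, one for each leg, add up to
`k γ_k - 1`. The centre together with a vertex in the middle of each further block of `2k` vertices
on every leg is a dominating set. It has at least `γ_k` elements, which is possible only if every
quotient `m / k` is `0` or `1`, exactly `γ_k - 1` of them are `1`, and the remainders add up to
`k - 1`. Choosing on every long leg the vertex at level `r + 1`, where `r` is its remainder, gives
only `γ_k - 1` vertices. So some short leg is not dominated by them and, as there are at least two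
long legs, this puts the whole remainder `k - 1` on that one short leg.
-/

namespace ZagrebIndex

open SimpleGraph

section Distance

variable {V : Type*} {G : SimpleGraph V}

theorem exists_adj_dist_add_one_eq (hG : G.Connected) {u v : V} (huv : u ≠ v) :
    ∃ w, G.Adj u w ∧ G.dist w v + 1 = G.dist u v := by
  obtain ⟨p, hp⟩ := hG.exists_walk_length_eq_dist u v
  cases p with
  | nil => exact absurd rfl huv
  | @cons _ w _ hadj p =>
    refine ⟨w, hadj, ?_⟩
    have hle := dist_le p
    have htri := hG.dist_triangle (u := u) (v := w) (w := v)
    rw [dist_eq_one_iff_adj.2 hadj] at htri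
    rw [Walk.length_cons] at hp
    omega

theorem exists_dist_eq_and_dist_add_dist_eq (hG : G.Connected) {r u v : V} {i : ℕ}
    (hu : G.dist r u ≤ i) (hv : i ≤ G.dist r v) :
    ∃ w, G.dist r w = i ∧ G.dist u w + G.dist w v = G.dist u v := by
  induction hd : G.dist u v generalizing u with
  | zero =>
    obtain rfl := (hG.dist_eq_zero_iff).1 hd
    exact ⟨u, le_antisymm hu hv, by simp⟩
  | succ d ih =>
    rcases hu.eq_or_lt with hu | hu
    · exact ⟨u, hu, by simpa using hd⟩
    · have huv : u ≠ v := by rintro rfl; simp at hd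
      obtain ⟨u', hadj, hu'⟩ := exists_adj_dist_add_one_eq hG huv
      have hone : G.dist u u' = 1 := dist_eq_one_iff_adj.2 hadj
      have hr := hG.dist_triangle (u := r) (v := u) (w := u')
      obtain ⟨w, hw, hsum⟩ := ih (u := u') (by omega) (by omega)
      have h₁ := hG.dist_triangle (u := u) (v := u') (w := w)
      have h₂ := hG.dist_triangle (u := u) (v := w) (w := v)
      exact ⟨w, hw, by omega⟩

theorem edist_map_le {W : Type*} {H : SimpleGraph W} (f : G →g H) (u v : V) :
    H.edist (f u) (f v) ≤ G.edist u v := by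
  by_cases h : G.edist u v = ⊤
  · simp [h]
  · obtain ⟨p, hp⟩ := exists_walk_of_edist_ne_top h
    simpa [hp] using edist_le (p.map f)

end Distance

section Domination

variable {V : Type*} {G : SimpleGraph V} {k : ℕ} {D : Finset V}

theorem isDistDominating_iff : G.IsDistDominating k D ↔ ∀ u, ∃ v ∈ D, G.edist u v ≤ k := by
  refine ⟨fun hD u => ?_, fun h u _ => h u⟩
  by_cases hu : u ∈ D
  · exact ⟨u, hu, by simp⟩
  · exact hD u hu

theorem isDistDominating_iff_dist_le (hG : G.Connected) :
    G.IsDistDominating k D ↔ ∀ u, ∃ v ∈ D, G.dist u v ≤ k := by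
  simp only [isDistDominating_iff, ← (hG _ _).coe_dist_eq_edist, Nat.cast_le]

variable [Fintype V]

theorem distDominationNumber_le_card (hD : G.IsDistDominating k D) :
    G.distDominationNumber k ≤ D.card :=
  Nat.sInf_le ⟨D, hD, rfl⟩

theorem exists_isDistDominating_card_eq (G : SimpleGraph V) (k : ℕ) :
    ∃ D : Finset V, G.IsDistDominating k D ∧ D.card = G.distDominationNumber k :=
  Nat.sInf_mem (s := {m | ∃ D : Finset V, G.IsDistDominating k D ∧ D.card = m})
    ⟨_, Finset.univ, fun u hu => absurd (Finset.mem_univ u) hu, rfl⟩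

theorem distDominationNumber_add_le_of_hom {W : Type*} [Fintype W] {H : SimpleGraph W}
    (f : G →g H) {r : ℕ} (hf : ∀ y, ∃ x, H.edist y (f x) ≤ r) (k : ℕ) :
    H.distDominationNumber (r + k) ≤ G.distDominationNumber k := by
  classical
  obtain ⟨D, hD, hcard⟩ := exists_isDistDominating_card_eq G k
  rw [← hcard]
  refine (distDominationNumber_le_card (isDistDominating_iff.2 fun y => ?_)).trans
    (Finset.card_image_le (f := f))
  obtain ⟨x, hx⟩ := hf y
  obtain ⟨v, hv, hxv⟩ := isDistDominating_iff.1 hD x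
  refine ⟨f v, Finset.mem_image_of_mem f hv, ?_⟩
  calc H.edist y (f v) ≤ H.edist y (f x) + H.edist (f x) (f v) := SimpleGraph.edist_triangle
    _ ≤ r + k := add_le_add hx ((edist_map_le f x v).trans hxv)
    _ = (r + k : ℕ) := by push_cast; rfl

theorem distDominationNumber_congr {W : Type*} [Fintype W] {H : SimpleGraph W} (e : G ≃g H)
    (k : ℕ) : G.distDominationNumber k = H.distDominationNumber k := by
  refine le_antisymm ?_ ?_
  · simpa using distDominationNumber_add_le_of_hom (r := 0) e.symm.toHom
      (fun x => ⟨e x, by simp⟩) k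
  · simpa using distDominationNumber_add_le_of_hom (r := 0) e.toHom
      (fun y => ⟨e.symm y, by simp⟩) k

theorem exists_lt_dist_of_two_le_distDominationNumber (hG : G.Connected)
    (hγ : 2 ≤ G.distDominationNumber k) (x : V) : ∃ r, k < G.dist r x := by
  by_contra! hle
  have hdom : G.IsDistDominating k {x} :=
    (isDistDominating_iff_dist_le hG).2 fun u => ⟨x, Finset.mem_singleton_self x, hle u⟩
  have := distDominationNumber_le_card hdom
  rw [Finset.card_singleton] at this
  omega

theorem nontrivial_of_two_le_distDominationNumber (hG : G.Connected)
    (hγ : 2 ≤ G.distDominationNumber k) : Nontrivial V := by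
  have ⟨x⟩ := hG.nonempty
  obtain ⟨r, hr⟩ := exists_lt_dist_of_two_le_distDominationNumber hG hγ x
  exact ⟨r, x, by rintro rfl; simp at hr⟩

/- A vertex below the first sphere of the class lies on a geodesic to `x` crossing that sphere, and
since `r` is farthest from `x` the crossing point is near; any other vertex looks towards `r`. -/
theorem isDistDominating_residueClass (hG : G.Connected) {r x : V}
    (hmax : ∀ u, G.dist u x ≤ G.dist r x) {i : ℕ} (hik : i ≤ k) (hir : i ≤ G.dist r x) :
    G.IsDistDominating k {v | G.dist r v % (k + 1) = i} := by
  refine (isDistDominating_iff_dist_le hG).2 fun u => ?_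
  simp only [Finset.mem_filter, Finset.mem_univ, true_and]
  rcases lt_or_ge (G.dist r u) i with hu | hu
  · obtain ⟨w, hw, hsum⟩ := exists_dist_eq_and_dist_add_dist_eq hG hu.le hir
    have htri := hG.dist_triangle (u := r) (v := w) (w := x)
    have hfar := hmax u
    exact ⟨w, by rw [hw, Nat.mod_eq_of_lt (by omega)], by omega⟩
  · have hdiv := Nat.div_add_mod (G.dist r u - i) (k + 1)
    have hmod := Nat.mod_lt (G.dist r u - i) (show 0 < k + 1 by omega)
    obtain ⟨w, hw, hsum⟩ := exists_dist_eq_and_dist_add_dist_eq hG (r := r) (u := r) (v := u)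
      (i := i + (k + 1) * ((G.dist r u - i) / (k + 1))) (by simp) (by omega)
    refine ⟨w, by rw [hw, Nat.add_mul_mod_self_left, Nat.mod_eq_of_lt (by omega)], ?_⟩
    rw [dist_comm]
    omega

theorem mul_distDominationNumber_le_card (hG : G.Connected)
    (hγ : 2 ≤ G.distDominationNumber k) :
    (k + 1) * G.distDominationNumber k ≤ Fintype.card V := by
  have ⟨x⟩ := hG.nonempty
  obtain ⟨r, -, hmax⟩ := Finset.univ.exists_max_image (G.dist · x) ⟨x, Finset.mem_univ x⟩
  obtain ⟨r', hr'⟩ := exists_lt_dist_of_two_le_distDominationNumber hG hγ x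
  have hr : k < G.dist r x := hr'.trans_le (hmax r' (Finset.mem_univ r'))
  by_contra! hlt
  obtain ⟨i, hi, hcard⟩ := Finset.exists_card_fiber_lt_of_card_lt_mul
    (s := (Finset.univ : Finset V)) (t := Finset.range (k + 1)) (f := fun v => G.dist r v % (k + 1))
    (n := G.distDominationNumber k) (by simpa using hlt)
  rw [Finset.mem_range] at hi
  exact hcard.not_ge (distDominationNumber_le_card (isDistDominating_residueClass hG
    (fun u => hmax u (Finset.mem_univ u)) (by omega) (by omega)))

end Domination

section NonLeaves

variable {V : Type*} [Fintype V] {G : SimpleGraph V} [DecidableRel G.Adj]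

/-- The inner vertices of a graph: those of degree at least two. In a nontrivial connected graph
they are the vertices that are not leaves. -/
def nonLeaves (G : SimpleGraph V) [DecidableRel G.Adj] : Finset V := {v | 2 ≤ G.degree v}

theorem mem_nonLeaves {v : V} : v ∈ nonLeaves G ↔ 2 ≤ G.degree v := by simp [nonLeaves]

theorem degree_eq_one_of_notMem_nonLeaves [Nontrivial V] (hG : G.Connected) {v : V}
    (hv : v ∉ nonLeaves G) : G.degree v = 1 := by
  have hpos := hG.preconnected.degree_pos_of_nontrivial v
  rw [mem_nonLeaves] at hv
  omega

theorem eq_or_eq_of_adj_of_degree_eq_one (hG : G.Connected) {u v : V} (huv : G.Adj u v)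
    (hu : G.degree u = 1) (hv : G.degree v = 1) (x : V) : x = u ∨ x = v := by
  by_contra! hx
  obtain ⟨u', hu', hdu⟩ := exists_adj_dist_add_one_eq hG hx.1.symm
  obtain ⟨v', hv', hdv⟩ := exists_adj_dist_add_one_eq hG hx.2.symm
  obtain rfl := (degree_eq_one_iff_existsUnique_adj.1 hu).unique hu' huv
  obtain rfl := (degree_eq_one_iff_existsUnique_adj.1 hv).unique hv' huv.symm
  omega

theorem exists_mem_nonLeaves_adj (hG : G.Connected) {k : ℕ} (hk : 1 ≤ k)
    (hγ : 2 ≤ G.distDominationNumber k) {v : V} (hv : v ∉ nonLeaves G) :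
    ∃ w ∈ nonLeaves G, G.Adj v w := by
  have := nontrivial_of_two_le_distDominationNumber hG hγ
  have hdeg := degree_eq_one_of_notMem_nonLeaves hG hv
  obtain ⟨w, hvw, -⟩ := degree_eq_one_iff_existsUnique_adj.1 hdeg
  refine ⟨w, by_contra fun hw => ?_, hvw⟩
  obtain ⟨r, hr⟩ := exists_lt_dist_of_two_le_distDominationNumber hG hγ v
  rcases eq_or_eq_of_adj_of_degree_eq_one hG hvw hdeg
    (degree_eq_one_of_notMem_nonLeaves hG hw) r with rfl | rfl
  · simp at hr
  · rw [dist_eq_one_iff_adj.2 hvw.symm] at hr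
    omega

theorem connected_induce_nonLeaves [Nontrivial V] (hG : G.Connected)
    (hne : (nonLeaves G).Nonempty) : (G.induce (nonLeaves G : Set V)).Connected := by
  have : Nonempty (nonLeaves G : Set V) := hne.to_subtype
  refine ⟨hG.preconnected.induce_of_degree_eq_one fun v hv => ?_⟩
  have hunique := degree_eq_one_iff_existsUnique_adj.1 (degree_eq_one_of_notMem_nonLeaves hG hv)
  exact fun _ ha _ hb => hunique.unique ha hb

theorem mul_distDominationNumber_le_card_nonLeaves (hG : G.Connected) {k : ℕ} (hk : 1 ≤ k)
    (hγ : 2 ≤ G.distDominationNumber k) :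
    k * G.distDominationNumber k ≤ (nonLeaves G).card := by
  have hnbr {v : V} := exists_mem_nonLeaves_adj hG hk hγ (v := v)
  have := nontrivial_of_two_le_distDominationNumber hG hγ
  have hne : (nonLeaves G).Nonempty := by
    have ⟨v⟩ := hG.nonempty
    by_cases hv : v ∈ nonLeaves G
    · exact ⟨v, hv⟩
    · exact (hnbr hv).imp fun _ => And.left
  obtain ⟨j, rfl⟩ := Nat.exists_eq_add_of_le hk
  have hγj : G.distDominationNumber (1 + j)
      ≤ (G.induce (nonLeaves G : Set V)).distDominationNumber j := by
    refine distDominationNumber_add_le_of_hom (Embedding.induce _).toHom (fun y => ?_) j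
    by_cases hy : y ∈ nonLeaves G
    · exact ⟨⟨y, hy⟩, by simp⟩
    · obtain ⟨w, hw, hyw⟩ := hnbr hy
      exact ⟨⟨w, hw⟩, (edist_eq_one_iff_adj.2 hyw).le⟩
  calc (1 + j) * G.distDominationNumber (1 + j)
      ≤ (j + 1) * (G.induce (nonLeaves G : Set V)).distDominationNumber j := by
        rw [add_comm 1 j] at hγj ⊢
        exact Nat.mul_le_mul_left _ hγj
    _ ≤ Fintype.card (nonLeaves G : Set V) :=
        mul_distDominationNumber_le_card (connected_induce_nonLeaves hG hne) (hγ.trans hγj)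
    _ = (nonLeaves G).card := Fintype.card_coe _

end NonLeaves

section Convexity

variable {f : ℝ → ℝ} {c : ℝ}

theorem convexOn_add_le_add {a b : ℝ} (hf : ConvexOn ℝ (Set.Ici c) f) (ha : c ≤ a) (hb : c ≤ b) :
    f a + f b ≤ f (a + b - c) + f c := by
  rcases ha.eq_or_lt with rfl | ha
  · rw [add_sub_cancel_left, add_comm]
  rcases hb.eq_or_lt with rfl | hb
  · rw [add_sub_cancel_right]
  have hz : a + b - c ∈ Set.Ici c := Set.mem_Ici.2 (by linarith)
  have h₁ := hf.secant_mono_aux1 Set.self_mem_Ici hz ha (by linarith)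
  have h₂ := hf.secant_mono_aux1 Set.self_mem_Ici hz hb (by linarith)
  refine le_of_mul_le_mul_left ?_ (show 0 < (a - c) + (b - c) by linarith)
  linear_combination h₁ + h₂

theorem strictConvexOn_add_lt_add {a b : ℝ} (hf : StrictConvexOn ℝ (Set.Ici c) f) (ha : c < a)
    (hb : c < b) : f a + f b < f (a + b - c) + f c := by
  have hz : a + b - c ∈ Set.Ici c := Set.mem_Ici.2 (by linarith)
  have h₁ := hf.secant_strict_mono_aux1 Set.self_mem_Ici hz ha (by linarith)
  have h₂ := hf.secant_strict_mono_aux1 Set.self_mem_Ici hz hb (by linarith)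
  refine lt_of_mul_lt_mul_left ?_ (show 0 ≤ (a - c) + (b - c) by linarith)
  linear_combination h₁ + h₂

variable {α : Type*} {S : Finset α} {d : α → ℝ}

theorem convexOn_add_sum_le {y : ℝ} (hf : ConvexOn ℝ (Set.Ici c) f) (hy : c ≤ y)
    (hd : ∀ v ∈ S, c ≤ d v) :
    f y + ∑ v ∈ S, f (d v) ≤ f (y + ∑ v ∈ S, (d v - c)) + S.card * f c := by
  classical
  induction S using Finset.induction_on with
  | empty => simp
  | insert a S ha ih =>
    rw [Finset.forall_mem_insert] at hd
    have hsum : 0 ≤ ∑ v ∈ S, (d v - c) := Finset.sum_nonneg fun v hv => sub_nonneg.2 (hd.2 v hv)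
    have hpair := convexOn_add_le_add hf (a := y + ∑ v ∈ S, (d v - c)) (by linarith) hd.1
    rw [Finset.sum_insert ha, Finset.sum_insert ha, Finset.card_insert_of_notMem ha,
      show y + (d a - c + ∑ v ∈ S, (d v - c)) = y + ∑ v ∈ S, (d v - c) + d a - c by ring]
    push_cast
    linarith [ih hd.2]

theorem strictConvexOn_add_sum_lt {y : ℝ} (hf : StrictConvexOn ℝ (Set.Ici c) f) (hy : c < y)
    (hd : ∀ v ∈ S, c ≤ d v) {u : α} (hu : u ∈ S) (hcu : c < d u) :
    f y + ∑ v ∈ S, f (d v) < f (y + ∑ v ∈ S, (d v - c)) + S.card * f c := by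
  classical
  have hpair := strictConvexOn_add_lt_add hf hy hcu
  have hrest := convexOn_add_sum_le hf.convexOn (S := S.erase u) (d := d) (y := y + d u - c)
    (by linarith) fun v hv => hd v (Finset.mem_of_mem_erase hv)
  rw [← Finset.insert_erase hu, Finset.sum_insert (Finset.notMem_erase u S),
    Finset.sum_insert (Finset.notMem_erase u S),
    Finset.card_insert_of_notMem (Finset.notMem_erase u S),
    show y + (d u - c + ∑ v ∈ S.erase u, (d v - c))
      = y + d u - c + ∑ v ∈ S.erase u, (d v - c) by ring]
  push_cast
  linarith

theorem strictConvexOn_add_sum_lt_of_ne (hf : StrictConvexOn ℝ (Set.Ici c) f)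
    (hd : ∀ v ∈ S, c ≤ d v) {u v : α} (hu : u ∈ S) (hv : v ∈ S) (huv : u ≠ v) (hcu : c < d u)
    (hcv : c < d v) :
    f c + ∑ w ∈ S, f (d w) < f (c + ∑ w ∈ S, (d w - c)) + S.card * f c := by
  classical
  have hrest := strictConvexOn_add_sum_lt hf (S := S.erase u) (d := d) hcu
    (fun w hw => hd w (Finset.mem_of_mem_erase hw)) (Finset.mem_erase.2 ⟨huv.symm, hv⟩) hcv
  rw [← Finset.insert_erase hu, Finset.sum_insert (Finset.notMem_erase u S),
    Finset.sum_insert (Finset.notMem_erase u S), ← add_assoc c, add_sub_cancel,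
    Finset.card_insert_of_notMem (Finset.notMem_erase u S)]
  push_cast
  linarith

end Convexity

section DegreeSum

/-- For a tree `T_{n,k,σ}` with `s = k σ`, the sum of `f` over the vertex degrees: the centre has
degree `n - s`, there are `s - 1` further inner vertices, all of degree two, and `n - s` leaves. -/
def extremalDegreeSum (f : ℝ → ℝ) (n s : ℕ) : ℝ :=
  f (n - s) + (s - 1) * f 2 + (n - s) * f 1

variable {V : Type*} [Fintype V] {T : SimpleGraph V} [DecidableRel T.Adj]

theorem sum_degree_add_two (hT : T.IsTree) : ∑ v, T.degree v + 2 = 2 * Fintype.card V := by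
  classical
  rw [sum_degrees_eq_twice_card_edges, ← hT.card_edgeFinset, mul_add]

theorem two_le_cast_degree {S : Finset V} (hS : S ⊆ nonLeaves T) {v : V} (hv : v ∈ S) :
    (2 : ℝ) ≤ T.degree v :=
  mod_cast mem_nonLeaves.1 (hS hv)

theorem one_le_cast_degree [Nontrivial V] (hT : T.Connected) (v : V) : (1 : ℝ) ≤ T.degree v :=
  mod_cast hT.preconnected.degree_pos_of_nontrivial v

theorem two_le_two_add_sum_degree {S : Finset V} (hS : S ⊆ nonLeaves T) :
    2 ≤ 2 + ∑ v ∈ S, ((T.degree v : ℝ) - 2) :=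
  le_add_of_nonneg_right (Finset.sum_nonneg fun _ hv => sub_nonneg.2 (two_le_cast_degree hS hv))

/- Merging the surplus over `2` of the degrees in `S` into a single vertex, and then adding the
surplus over `1` of the remaining degrees, produces the degrees of the extremal tree. -/
theorem extremalDegreeSum_sub_sum_degree [DecidableEq V] (hT : T.IsTree) (f : ℝ → ℝ)
    (S : Finset V) {m : ℝ} (hm : m = 2 + ∑ v ∈ S, ((T.degree v : ℝ) - 2)) :
    extremalDegreeSum f (Fintype.card V) S.card - ∑ v, f (T.degree v)
      = (f m + S.card * f 2 - (f 2 + ∑ v ∈ S, f (T.degree v)))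
        + (f (m + ∑ v ∈ Sᶜ, ((T.degree v : ℝ) - 1)) + Sᶜ.card * f 1
          - (f m + ∑ v ∈ Sᶜ, f (T.degree v))) := by
  have hhand : ∑ v, (T.degree v : ℝ) + 2 = 2 * Fintype.card V := by
    exact_mod_cast sum_degree_add_two hT
  have hcard : (Sᶜ.card : ℝ) = Fintype.card V - S.card := by
    rw [Finset.card_compl, Nat.cast_sub S.card_le_univ]
  have hcentre : m + ∑ v ∈ Sᶜ, ((T.degree v : ℝ) - 1) = Fintype.card V - S.card := by
    rw [← Finset.sum_add_sum_compl S] at hhand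
    simp only [hm, Finset.sum_sub_distrib, Finset.sum_const, nsmul_eq_mul]
    linarith
  rw [hcentre, hcard, extremalDegreeSum, ← Finset.sum_add_sum_compl S]
  ring

variable [Nontrivial V] {f : ℝ → ℝ} {S : Finset V}

theorem sum_degree_le_extremalDegreeSum (hT : T.IsTree) (hf : ConvexOn ℝ (Set.Ici 1) f)
    (hS : S ⊆ nonLeaves T) :
    ∑ v, f (T.degree v) ≤ extremalDegreeSum f (Fintype.card V) S.card := by
  classical
  have hf₂ := hf.subset (Set.Ici_subset_Ici.2 one_le_two) (convex_Ici 2)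
  have hinner := convexOn_add_sum_le hf₂ le_rfl fun v => two_le_cast_degree hS
  have houter := convexOn_add_sum_le hf (one_le_two.trans (two_le_two_add_sum_degree hS))
    fun v (_ : v ∈ Sᶜ) => one_le_cast_degree hT.connected v
  linarith [extremalDegreeSum_sub_sum_degree hT f S rfl]

theorem nonLeaves_eq_of_sum_degree_eq (hT : T.IsTree) (hf : StrictConvexOn ℝ (Set.Ici 1) f)
    (hS : S ⊆ nonLeaves T)
    (heq : ∑ v, f (T.degree v) = extremalDegreeSum f (Fintype.card V) S.card) :
    nonLeaves T = S := by
  classical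
  refine Finset.Subset.antisymm (fun u hu => by_contra fun huS => ?_) hS
  have hf₂ := hf.convexOn.subset (Set.Ici_subset_Ici.2 one_le_two) (convex_Ici 2)
  have hinner := convexOn_add_sum_le hf₂ le_rfl fun v => two_le_cast_degree hS
  have houter := strictConvexOn_add_sum_lt hf
    (one_lt_two.trans_le (two_le_two_add_sum_degree hS))
    (fun v (_ : v ∈ Sᶜ) => one_le_cast_degree hT.connected v) (Finset.mem_compl.2 huS)
    (one_lt_two.trans_le (two_le_cast_degree subset_rfl hu))
  linarith [extremalDegreeSum_sub_sum_degree hT f S rfl]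

theorem subsingleton_of_sum_degree_eq (hT : T.IsTree) (hf : StrictConvexOn ℝ (Set.Ici 1) f)
    (heq : ∑ v, f (T.degree v) = extremalDegreeSum f (Fintype.card V) (nonLeaves T).card) :
    {v | 3 ≤ T.degree v}.Subsingleton := by
  classical
  have hmem {v : V} (hv : 3 ≤ T.degree v) : v ∈ nonLeaves T := mem_nonLeaves.2 (by omega)
  have htwo {v : V} (hv : 3 ≤ T.degree v) : (2 : ℝ) < T.degree v := by exact_mod_cast hv
  refine fun u hu v hv => by_contra fun huv => ?_
  have hf₂ := hf.subset (Set.Ici_subset_Ici.2 one_le_two) (convex_Ici 2)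
  have hinner := strictConvexOn_add_sum_lt_of_ne hf₂ (fun v => two_le_cast_degree subset_rfl)
    (hmem hu) (hmem hv) huv (htwo hu) (htwo hv)
  have houter := convexOn_add_sum_le hf.convexOn
    (one_le_two.trans (two_le_two_add_sum_degree (T := T) subset_rfl))
    fun v (_ : v ∈ (nonLeaves T)ᶜ) => one_le_cast_degree hT.connected v
  linarith [extremalDegreeSum_sub_sum_degree hT f (nonLeaves T) rfl]

end DegreeSum

section Starlike

variable {ι : Type*} {len : ι → ℕ}

theorem starlike_adj {x y : Option (Σ i, Fin (len i))} :
    (starlike len).Adj x y ↔ starlikeRel len x y ∨ starlikeRel len y x := by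
  rw [starlike, fromRel_adj, and_iff_right_iff_imp]
  rintro h rfl
  rcases x with _ | x <;> simp [starlikeRel] at h

/-- The isomorphism of starlike trees obtained by permuting the legs. -/
def starlikeCongr {κ : Type*} {len' : κ → ℕ} (e : ι ≃ κ) (h : ∀ i, len i = len' (e i)) :
    starlike len ≃g starlike len' where
  toEquiv := Equiv.optionCongr (Equiv.sigmaCongr e fun i => finCongr (h i))
  map_rel_iff' := by
    have happly : ∀ x : Σ i, Fin (len i), Equiv.sigmaCongr e (fun i => finCongr (h i)) x
        = (⟨e x.1, finCongr (h x.1) x.2⟩ : Σ i, Fin (len' i)) := fun _ => rfl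
    rintro (_ | x) (_ | y) <;> simp [starlike_adj, starlikeRel, happly]

end Starlike

section Legs

theorem exists_equiv_sigma_fin {X ι : Type*} [Finite X] (leg : X → ι) (level : X → ℕ)
    (hinj : ∀ x y, leg x = leg y → level x = level y → x = y)
    (hdown : ∀ x, ∀ j ≤ level x, ∃ y, leg y = leg x ∧ level y = j) :
    ∃ (len : ι → ℕ) (e : X ≃ Σ i, Fin (len i)),
      ∀ x, (e x).1 = leg x ∧ ((e x).2 : ℕ) = level x := by
  classical
  have := Fintype.ofFinite X
  let len (i : ι) : ℕ := (Finset.univ.filter fun x => leg x = i).sup fun x => level x + 1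
  have hlen (i : ι) (j : ℕ) : j < len i ↔ ∃ x, leg x = i ∧ level x = j := by
    simp only [len, Finset.lt_sup_iff, Finset.mem_filter, Finset.mem_univ, true_and,
      Order.lt_add_one_iff]
    constructor
    · rintro ⟨x, rfl, hj⟩
      exact hdown x j hj
    · rintro ⟨x, hi, rfl⟩
      exact ⟨x, hi, le_rfl⟩
  let φ (x : X) : Σ i, Fin (len i) := ⟨leg x, level x, (hlen _ _).2 ⟨x, rfl, rfl⟩⟩
  have hφ : Function.Bijective φ := by
    constructor
    · intro x y hxy
      exact hinj x y (congrArg Sigma.fst hxy)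
        (congrArg (fun z : Σ i, Fin (len i) => (z.2 : ℕ)) hxy)
    · rintro ⟨i, j, hj⟩
      obtain ⟨x, rfl, rfl⟩ := (hlen i j).1 hj
      exact ⟨x, rfl⟩
  exact ⟨len, Equiv.ofBijective φ hφ, fun x => ⟨rfl, rfl⟩⟩

variable {V : Type*} {T : SimpleGraph V} {c u v w i : V}

/-- `w` is the neighbour of `u` through which a geodesic from `u` to `v` passes. With `u` the centre
of a starlike tree this names the leg of `v`; with `v` the centre it is the parent of `u`. -/
def IsNextTowards (G : SimpleGraph V) (u v w : V) : Prop :=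
  G.Adj u w ∧ G.dist w v + 1 = G.dist u v

theorem isNextTowards_unique (hT : T.IsTree) {w' : V} (hw : IsNextTowards T u v w)
    (hw' : IsNextTowards T u v w') : w = w' := by
  obtain ⟨p, hp⟩ := hT.connected.exists_walk_length_eq_dist w v
  obtain ⟨q, hq⟩ := hT.connected.exists_walk_length_eq_dist w' v
  have hp' := (p.cons hw.1).isPath_of_length_eq_dist (by rw [Walk.length_cons, hp, hw.2])
  have hq' := (q.cons hw'.1).isPath_of_length_eq_dist (by rw [Walk.length_cons, hq, hw'.2])
  have hpath := (hT.isAcyclic.subsingleton_path u v).elim ⟨_, hp'⟩ ⟨_, hq'⟩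
  simpa using congrArg (fun r : T.Path u v => r.1.snd) hpath

theorem isNextTowards_of_adj (hG : T.Connected) (huv : T.Adj u v)
    (hd : T.dist c v = T.dist c u + 1) (hu : IsNextTowards T c u i) : IsNextTowards T c v i := by
  have h₁ := hG.dist_triangle (u := i) (v := u) (w := v)
  have h₂ := hG.dist_triangle (u := c) (v := i) (w := v)
  rw [dist_eq_one_iff_adj.2 huv] at h₁
  rw [dist_eq_one_iff_adj.2 hu.1] at h₂
  exact ⟨hu.1, by have := hu.2; omega⟩

theorem isNextTowards_parent (hT : T.IsTree) (hv : IsNextTowards T v c u) (huc : u ≠ c)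
    (hi : IsNextTowards T c v i) : IsNextTowards T c u i := by
  obtain ⟨i', hi'⟩ := exists_adj_dist_add_one_eq hT.connected huc.symm
  have hd : T.dist c v = T.dist c u + 1 := by rw [dist_comm, ← hv.2, dist_comm]
  rwa [isNextTowards_unique hT hi (isNextTowards_of_adj hT.connected hv.1.symm hd hi')]

theorem exists_isNextTowards_dist_eq (hG : T.Connected) (hv : IsNextTowards T c v i) {t : ℕ}
    (ht : 1 ≤ t) (htv : t ≤ T.dist c v) : ∃ w, IsNextTowards T c w i ∧ T.dist c w = t := by
  have hci := dist_eq_one_iff_adj.2 hv.1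
  obtain ⟨w, hw, hsum⟩ := exists_dist_eq_and_dist_add_dist_eq hG (hci.trans_le ht) htv
  have h₁ := hG.dist_triangle (u := c) (v := w) (w := v)
  have h₂ := hG.dist_triangle (u := c) (v := i) (w := w)
  exact ⟨w, ⟨hv.1, by have := hv.2; omega⟩, hw⟩

theorem eq_of_isNextTowards_center [Fintype V] [DecidableRel T.Adj] (hT : T.IsTree) (hwc : w ≠ c)
    (hw : T.degree w ≤ 2) (hu : IsNextTowards T u c w) (hv : IsNextTowards T v c w) : u = v := by
  classical
  obtain ⟨p, hp⟩ := exists_adj_dist_add_one_eq hT.connected hwc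
  by_contra huv
  have hpu : p ≠ u := by rintro rfl; have := hu.2; omega
  have hpv : p ≠ v := by rintro rfl; have := hv.2; omega
  have hsub : ({p, u, v} : Finset V) ⊆ T.neighborFinset w := by
    simp [Finset.insert_subset_iff, hp.1, hu.1.symm, hv.1.symm]
  have hcard := Finset.card_le_card hsub
  rw [Finset.card_eq_three.2 ⟨p, u, v, hpu, hpv, huv, rfl⟩, card_neighborFinset_eq_degree] at hcard
  omega

theorem eq_of_isNextTowards_of_dist_eq [Fintype V] [DecidableRel T.Adj] (hT : T.IsTree)
    (hdeg : ∀ v, v ≠ c → T.degree v ≤ 2) (hu : IsNextTowards T c u i)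
    (hv : IsNextTowards T c v i) (hd : T.dist c u = T.dist c v) : u = v := by
  have hdu := hu.2
  have hdv := hv.2
  induction h : T.dist i u generalizing u v with
  | zero =>
    obtain rfl := hT.connected.dist_eq_zero_iff.1 h
    exact hT.connected.dist_eq_zero_iff.1 (show T.dist i v = 0 by omega)
  | succ d ih =>
    have hne {x : V} (hx : 1 < T.dist c x) : x ≠ c := by rintro rfl; simp at hx
    obtain ⟨p, hp⟩ := exists_adj_dist_add_one_eq hT.connected (hne (x := u) (by omega))
    obtain ⟨q, hq⟩ := exists_adj_dist_add_one_eq hT.connected (hne (x := v) (by omega))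
    have hcp : T.dist c p + 1 = T.dist c u := by rw [dist_comm, hp.2, dist_comm]
    have hcq : T.dist c q + 1 = T.dist c v := by rw [dist_comm, hq.2, dist_comm]
    have hpc : p ≠ c := by rintro rfl; rw [dist_self] at hcp; omega
    have hqc : q ≠ c := by rintro rfl; rw [dist_self] at hcq; omega
    have hip := isNextTowards_parent hT hp hpc hu
    have hiq := isNextTowards_parent hT hq hqc hv
    obtain rfl := ih hip hiq (by omega) hip.2 hiq.2 (by have := hip.2; omega)
    exact eq_of_isNextTowards_center hT hpc (hdeg p hpc) hp hq

theorem adj_iff_eq_of_dist_eq_add_one [Fintype V] [DecidableRel T.Adj] (hT : T.IsTree)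
    (hdeg : ∀ v, v ≠ c → T.degree v ≤ 2) {j : V} (hu : IsNextTowards T c u i)
    (hv : IsNextTowards T c v j) (hd : T.dist c v = T.dist c u + 1) : T.Adj u v ↔ i = j := by
  constructor
  · exact fun huv => isNextTowards_unique hT (isNextTowards_of_adj hT.connected huv hd hu) hv
  · rintro rfl
    have hvc : v ≠ c := by rintro rfl; simp at hd
    obtain ⟨p, hp⟩ := exists_adj_dist_add_one_eq hT.connected hvc
    have hcp : T.dist c p + 1 = T.dist c v := by rw [dist_comm, hp.2, dist_comm]
    have hpc : p ≠ c := by rintro rfl; have := hu.2; rw [dist_self] at hcp; omega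
    obtain rfl := eq_of_isNextTowards_of_dist_eq hT hdeg (isNextTowards_parent hT hp hpc hv) hu
      (by omega)
    exact hp.1.symm

theorem nonempty_iso_starlike_of_legs (hT : T.IsTree) {ι : Type*} {len : ι → ℕ}
    (e : {v // v ≠ c} ≃ Σ i, Fin (len i)) (hlevel : ∀ v, ((e v).2 : ℕ) + 1 = T.dist c v)
    (hadj : ∀ u v : {v // v ≠ c}, T.dist c v = T.dist c u + 1 →
      (T.Adj u v ↔ (e u).1 = (e v).1)) :
    Nonempty (T ≃g starlike len) := by
  classical
  have hrel (u v : {v // v ≠ c}) :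
      starlikeRel len (some (e u)) (some (e v)) ↔ T.Adj u v ∧ T.dist c v = T.dist c u + 1 := by
    rw [and_congr_left (hadj u v), ← hlevel, ← hlevel, Nat.add_right_cancel_iff]
    exact and_congr_right fun _ => eq_comm
  have hcenter (v : {v // v ≠ c}) : starlikeRel len none (some (e v)) ↔ T.Adj c v := by
    rw [← dist_eq_one_iff_adj, ← hlevel]
    simp only [starlikeRel, Nat.add_eq_right]
  let φ : Option (Σ i, Fin (len i)) ≃ V :=
    (Equiv.optionCongr e.symm).trans (Equiv.optionSubtypeNe c)
  have hnone : φ none = c := rfl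
  have hsome (v : {v // v ≠ c}) : φ (some (e v)) = v :=
    congrArg Subtype.val (e.symm_apply_apply v)
  refine ⟨RelIso.symm ⟨φ, fun {x y} => ?_⟩⟩
  rw [starlike_adj]
  rcases x with _ | x <;> rcases y with _ | y
  · simp [starlikeRel]
  · obtain ⟨v, rfl⟩ := e.surjective y
    rw [hnone, hsome, hcenter, starlikeRel, or_false]
  · obtain ⟨v, rfl⟩ := e.surjective x
    rw [hnone, hsome, hcenter, starlikeRel, false_or, T.adj_comm]
  · obtain ⟨u, rfl⟩ := e.surjective x
    obtain ⟨v, rfl⟩ := e.surjective y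
    rw [hsome, hsome, hrel, hrel, T.adj_comm v u, ← and_or_left, iff_self_and]
    exact fun h => (hT.dist_eq_dist_add_one_of_adj c h).symm

theorem exists_iso_starlike [Fintype V] [DecidableRel T.Adj] (hT : T.IsTree) (c : V)
    (hdeg : ∀ v, v ≠ c → T.degree v ≤ 2) :
    ∃ len : T.neighborSet c → ℕ, (∀ i, 1 ≤ len i) ∧ Nonempty (T ≃g starlike len) := by
  have hex (v : {v // v ≠ c}) : ∃ i : T.neighborSet c, IsNextTowards T c v i := by
    obtain ⟨i, hi⟩ := exists_adj_dist_add_one_eq hT.connected v.2.symm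
    exact ⟨⟨i, hi.1⟩, hi⟩
  choose leg hleg using hex
  have hpos (v : {v // v ≠ c}) : 0 < T.dist c v := hT.connected.pos_dist_of_ne v.2.symm
  obtain ⟨len, e, he⟩ := exists_equiv_sigma_fin leg (fun v => T.dist c v - 1)
    (fun u v hl hd => Subtype.ext (eq_of_isNextTowards_of_dist_eq hT hdeg (hleg u)
      (hl ▸ hleg v) (by have := hpos u; have := hpos v; omega)))
    (fun v j hj => by
      obtain ⟨w, hw, hd⟩ := exists_isNextTowards_dist_eq hT.connected (hleg v)
        (Nat.le_add_left 1 j) (by have := hpos v; omega)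
      have hwc : w ≠ c := by rintro rfl; simp at hd
      exact ⟨⟨w, hwc⟩, Subtype.ext (isNextTowards_unique hT (hleg _) hw), by simp [hd]⟩)
  refine ⟨len, fun i => ?_, nonempty_iso_starlike_of_legs hT e (fun v => ?_) fun u v hd => ?_⟩
  · have hi : IsNextTowards T c i i := ⟨i.2, by simp [dist_eq_one_iff_adj.2 i.2]⟩
    let x : {v // v ≠ c} := ⟨i, i.2.ne'⟩
    have hx : (e x).1 = i := by
      rw [(he x).1]
      exact Subtype.ext (isNextTowards_unique hT (hleg x) hi)
    have := (e x).2.pos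
    rwa [hx] at this
  · have := hpos v
    have := (he v).2
    omega
  · rw [(he u).1, (he v).1, ← Subtype.coe_inj]
    exact adj_iff_eq_of_dist_eq_add_one hT hdeg (hleg u) (hleg v) hd

end Legs

section StarlikeDomination

variable {ι : Type*} {len : ι → ℕ} {k s : ℕ}

theorem starlike_edist_leg_le {i : ι} (j j' : Fin (len i)) :
    (starlike len).edist (some ⟨i, j⟩) (some ⟨i, j'⟩) ≤ (j' - j + (j - j') : ℕ) := by
  wlog h : j ≤ j' generalizing j j'
  · rw [edist_comm, add_comm]
    exact this j' j (le_of_not_ge h)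
  obtain ⟨j, hj⟩ := j
  obtain ⟨j', hj'⟩ := j'
  rw [Fin.mk_le_mk] at h
  induction j', h using Nat.le_induction with
  | base => simp
  | succ m hm ih =>
    have hadj : (starlike len).Adj (some ⟨i, m, by omega⟩) (some ⟨i, m + 1, hj'⟩) :=
      starlike_adj.2 (.inl ⟨rfl, rfl⟩)
    calc (starlike len).edist (some ⟨i, j, hj⟩) (some ⟨i, m + 1, hj'⟩)
        ≤ (m - j + (j - m) : ℕ) + 1 :=
          SimpleGraph.edist_triangle.trans
            (add_le_add (ih (by omega)) (edist_eq_one_iff_adj.2 hadj).le)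
      _ ≤ (m + 1 - j + (j - (m + 1)) : ℕ) := by norm_cast; omega

theorem starlike_edist_none_le {i : ι} (j : Fin (len i)) :
    (starlike len).edist none (some ⟨i, j⟩) ≤ (j + 1 : ℕ) := by
  have hadj : (starlike len).Adj none (some ⟨i, 0, j.pos⟩) := starlike_adj.2 (.inl rfl)
  calc (starlike len).edist none (some ⟨i, j⟩)
      ≤ 1 + (j - 0 + (0 - j) : ℕ) :=
        SimpleGraph.edist_triangle.trans
          (add_le_add (edist_eq_one_iff_adj.2 hadj).le (starlike_edist_leg_le _ j))
    _ ≤ (j + 1 : ℕ) := by norm_cast; omega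

theorem starlike_edist_le {i i' : ι} (j : Fin (len i)) (j' : Fin (len i')) :
    (starlike len).edist (some ⟨i, j⟩) (some ⟨i', j'⟩) ≤ (j + 1 + (j' + 1) : ℕ) := by
  refine (SimpleGraph.edist_triangle (v := none)).trans ?_
  rw [edist_comm, Nat.cast_add]
  exact add_le_add (starlike_edist_none_le j) (starlike_edist_none_le j')

theorem exists_lt_near_min_mul (hk : 1 ≤ k) {j l : ℕ} (hkj : k ≤ j) (hjl : j < l) :
    ∃ t < ((l - 1) / k + 1) / 2,
      min (2 * k * (t + 1)) l - 1 - j + (j - (min (2 * k * (t + 1)) l - 1)) ≤ k := by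
  have hk₂ : 0 < 2 * k := by omega
  have hdiv := Nat.div_add_mod (j - k) (2 * k)
  have hmod := Nat.mod_lt (j - k) hk₂
  refine ⟨(j - k) / (2 * k), ?_, by rw [mul_add, mul_one]; omega⟩
  rw [← Nat.add_div_right _ hk, Nat.div_div_eq_div_mul, mul_comm k 2, Nat.lt_iff_add_one_le,
    ← Nat.add_div_right _ hk₂]
  exact Nat.div_le_div_right (by omega)

variable [Fintype ι]

/- The centre dominates the first `k` vertices of every leg, and each further dominating vertex of
a leg takes care of the next `2k` of them. -/
theorem distDominationNumber_starlike_le (hk : 1 ≤ k) :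
    (starlike len).distDominationNumber k ≤ ∑ i, ((len i - 1) / k + 1) / 2 + 1 := by
  classical
  let f (x : Σ i, Fin (((len i - 1) / k + 1) / 2)) : Option (Σ i, Fin (len i)) :=
    some ⟨x.1, min (2 * k * (x.2 + 1)) (len x.1) - 1, by
      have hlen : len x.1 ≠ 0 := fun h => by simpa [h] using x.2.pos
      omega⟩
  have hcard : (insert none (Finset.univ.image f)).card
      ≤ ∑ i, ((len i - 1) / k + 1) / 2 + 1 :=
    (Finset.card_insert_le _ _).trans
      (Nat.succ_le_succ (Finset.card_image_le.trans_eq (by simp)))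
  refine (distDominationNumber_le_card (isDistDominating_iff.2 ?_)).trans hcard
  rintro (_ | ⟨i, j⟩)
  · exact ⟨none, by simp⟩
  rcases lt_or_ge j.val k with hj | hj
  · refine ⟨none, by simp, ?_⟩
    rw [edist_comm]
    exact (starlike_edist_none_le j).trans (mod_cast hj)
  · obtain ⟨t, ht, hnear⟩ := exists_lt_near_min_mul hk hj j.2
    exact ⟨f ⟨i, t, ht⟩, by simp, (starlike_edist_leg_le _ _).trans (mod_cast hnear)⟩

theorem distDominationNumber_starlike_le_card {L : Finset ι} (hne : L.Nonempty) {r : ι → ℕ}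
    (hrk : ∀ i ∈ L, r i < k) (hrlen : ∀ i ∈ L, r i < len i)
    (hlong : ∀ i ∈ L, len i ≤ k + r i + 1) (hshort : ∀ i ∉ L, ∃ l ∈ L, len i + r l + 1 ≤ k) :
    (starlike len).distDominationNumber k ≤ L.card := by
  classical
  let f (i : L) : Option (Σ i, Fin (len i)) := some ⟨i, r i, hrlen i i.2⟩
  have hmem (l : L) : f l ∈ Finset.univ.image f := Finset.mem_image_of_mem f (Finset.mem_univ l)
  have hcard : (Finset.univ.image f).card ≤ L.card := Finset.card_image_le.trans_eq (by simp)
  refine (distDominationNumber_le_card (isDistDominating_iff.2 ?_)).trans hcard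
  rintro (_ | ⟨i, j⟩)
  · obtain ⟨l, hl⟩ := hne
    exact ⟨_, hmem ⟨l, hl⟩, (starlike_edist_none_le _).trans (mod_cast hrk l hl)⟩
  have hj := j.2
  by_cases hi : i ∈ L
  · refine ⟨_, hmem ⟨i, hi⟩, (starlike_edist_leg_le _ _).trans (Nat.cast_le.2 ?_)⟩
    have := hrk i hi
    have := hlong i hi
    dsimp only
    omega
  · obtain ⟨l, hl, hle⟩ := hshort i hi
    refine ⟨_, hmem ⟨l, hl⟩, (starlike_edist_le _ _).trans (Nat.cast_le.2 ?_)⟩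
    dsimp only
    omega

end StarlikeDomination

section StarlikeLegs

variable {ι : Type*} [Fintype ι] {k s : ℕ}

/- The half-sum is at least `s - 1 ≥ ∑ i, m i / k`, so `(q + 1) / 2 ≤ q` is an equality for every
quotient `q`, which excludes `q ≥ 2`. -/
theorem exists_quotient_remainder_of_le_sum_half {m : ι → ℕ} (hk : 1 ≤ k)
    (hsum : ∑ i, m i + 1 = k * s) (hle : s ≤ ∑ i, (m i / k + 1) / 2 + 1) :
    ∃ (L : Finset ι) (r : ι → ℕ), L.card + 1 = s ∧ ∑ i, r i + 1 = k ∧ (∀ i, r i < k) ∧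
      (∀ i ∈ L, m i = k + r i) ∧ ∀ i ∉ L, m i = r i := by
  have hdiv : k * ∑ i, m i / k + ∑ i, m i % k + 1 = k * s := by
    rw [← hsum, Finset.mul_sum, ← Finset.sum_add_distrib]
    simp only [Nat.div_add_mod]
  have hlt : ∑ i, m i / k < s := Nat.lt_of_mul_lt_mul_left (a := k) (by omega)
  have hhalf (q : ℕ) : (q + 1) / 2 ≤ q := by omega
  have hhalf_sum := Finset.sum_le_sum fun i (_ : i ∈ Finset.univ) => hhalf (m i / k)
  have hq : ∑ i, m i / k + 1 = s := by omega
  have hq_le (i : ι) : m i / k = 0 ∨ m i / k = 1 := by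
    have := (Finset.sum_eq_sum_iff_of_le fun i _ => hhalf (m i / k)).1 (by omega) i
      (Finset.mem_univ i)
    generalize m i / k = q at this ⊢
    omega
  refine ⟨.filter (fun i => m i / k = 1) .univ, fun i => m i % k, ?_, ?_,
    fun i => Nat.mod_lt _ hk, fun i hi => ?_, fun i hi => ?_⟩
  · rw [← hq, Finset.card_filter]
    congr 1
    exact Finset.sum_congr rfl fun i _ => by rcases hq_le i with h | h <;> simp [h]
  · rw [← hq, mul_add, mul_one] at hdiv
    dsimp only
    omega
  · have hone : m i / k = 1 := (Finset.mem_filter.1 hi).2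
    have := Nat.div_add_mod (m i) k
    rw [hone, mul_one] at this
    exact this.symm
  · have hzero : m i / k = 0 := (hq_le i).resolve_right (by simpa using hi)
    simpa [hzero] using (Nat.div_add_mod (m i) k).symm

theorem eq_sum_and_eq_zero_of_sum_le_add {r : ι → ℕ} {a b i₀ : ι} (hab : a ≠ b) (ha : i₀ ≠ a)
    (hb : i₀ ≠ b) (hra : ∑ i, r i ≤ r i₀ + r a) (hrb : ∑ i, r i ≤ r i₀ + r b) :
    r i₀ = ∑ i, r i ∧ ∀ i ≠ i₀, r i = 0 := by
  classical
  have hthree := Finset.sum_le_sum_of_subset (f := r) (Finset.subset_univ {i₀, a, b})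
  rw [Finset.sum_insert (by simp [ha, hb]), Finset.sum_pair hab] at hthree
  refine ⟨by omega, fun i hi => ?_⟩
  have htwo := Finset.sum_le_sum_of_subset (f := r) (Finset.subset_univ {i₀, i})
  rw [Finset.sum_pair hi.symm] at htwo
  omega

variable {len : ι → ℕ}

theorem exists_legs_of_le_distDominationNumber_starlike (hlen : ∀ i, 1 ≤ len i) (hk : 1 ≤ k)
    (hs : 3 ≤ s) (hγ : s ≤ (starlike len).distDominationNumber k)
    (hsum : ∑ i, (len i - 1) + 1 = k * s) :
    ∃ (i₀ : ι) (L : Finset ι), i₀ ∉ L ∧ L.card + 1 = s ∧ len i₀ = k ∧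
      (∀ i ∈ L, len i = k + 1) ∧ ∀ i ∉ L, i ≠ i₀ → len i = 1 := by
  obtain ⟨L, r, hcard, hrsum, hr, hL, hL'⟩ := exists_quotient_remainder_of_le_sum_half hk hsum
    (hγ.trans (distDominationNumber_starlike_le hk))
  have hlong {i : ι} (hi : i ∈ L) : len i = k + r i + 1 := by
    rw [← hL i hi, Nat.sub_add_cancel (hlen i)]
  have hshort {i : ι} (hi : i ∉ L) : len i = r i + 1 := by
    rw [← hL' i hi, Nat.sub_add_cancel (hlen i)]
  obtain ⟨a, ha, b, hb, hab⟩ := Finset.one_lt_card.1 (show 1 < L.card by omega)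
  obtain ⟨i₀, hi₀, hfar⟩ : ∃ i ∉ L, ∀ l ∈ L, k ≤ len i + r l := by
    by_contra! hnear
    have := distDominationNumber_starlike_le_card ⟨a, ha⟩ (fun i _ => hr i)
      (fun i hi => by rw [hlong hi]; omega) (fun i hi => (hlong hi).le) hnear
    omega
  have hne {l : ι} (hl : l ∈ L) : i₀ ≠ l := by rintro rfl; exact hi₀ hl
  have hfar' {l : ι} (hl : l ∈ L) : ∑ i, r i ≤ r i₀ + r l := by
    have := hfar l hl
    rw [hshort hi₀] at this
    omega
  obtain ⟨hr₀, hzero⟩ :=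
    eq_sum_and_eq_zero_of_sum_le_add hab (hne ha) (hne hb) (hfar' ha) (hfar' hb)
  refine ⟨i₀, L, hi₀, hcard, ?_, fun i hi => ?_, fun i hi hii₀ => ?_⟩
  · rw [hshort hi₀, hr₀, hrsum]
  · rw [hlong hi, hzero i (hne hi).symm]
  · rw [hshort hi, hzero i hii₀]

theorem nonempty_starlike_iso_zagrebTree {n : ℕ} (hn : (k + 1) * s ≤ n)
    (hι : Fintype.card ι = n - k * s) {i₀ : ι} {L : Finset ι} (hi₀ : i₀ ∉ L)
    (hL : L.card + 1 = s) (hk : len i₀ = k) (hlenL : ∀ i ∈ L, len i = k + 1)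
    (hone : ∀ i ∉ L, i ≠ i₀ → len i = 1) :
    Nonempty (starlike len ≃g zagrebTree n k s) := by
  classical
  have hR : ((insert i₀ L)ᶜ).card = n - (k + 1) * s := by
    rw [Finset.card_compl, Finset.card_insert_of_notMem hi₀, hL, hι, add_mul, one_mul]
    omega
  let eL := (L.equivFinOfCardEq (Nat.eq_sub_of_add_eq hL)).symm
  let eR := (((insert i₀ L)ᶜ).equivFinOfCardEq hR).symm
  let f : Fin 1 ⊕ Fin (s - 1) ⊕ Fin (n - (k + 1) * s) → ι :=
    Sum.elim (fun _ => i₀) (Sum.elim (fun x => eL x) fun x => eR x)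
  have hmemR : ∀ x, (eR x : ι) ≠ i₀ ∧ (eR x : ι) ∉ L := fun x => by
    simpa [not_or] using (eR x).2
  have hsurj : Function.Surjective f := fun i => by
    by_cases h₀ : i = i₀
    · exact ⟨.inl 0, h₀.symm⟩
    by_cases hi : i ∈ L
    · exact ⟨.inr (.inl (eL.symm ⟨i, hi⟩)), by simp [f]⟩
    · exact ⟨.inr (.inr (eR.symm ⟨i, by simp [h₀, hi]⟩)), by simp [f]⟩
  have hbij : Function.Bijective f := by
    refine (Fintype.bijective_iff_surjective_and_card f).2 ⟨hsurj, ?_⟩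
    simp only [Fintype.card_sum, Fintype.card_fin, hι]
    rw [add_mul, one_mul] at hn ⊢
    omega
  refine ⟨(starlikeCongr (Equiv.ofBijective f hbij) ?_).symm⟩
  rintro (_ | x | x)
  · exact hk.symm
  · exact (hlenL _ (eL x).2).symm
  · exact (hone _ (hmemR x).2 (hmemR x).1).symm

end StarlikeLegs

section StarlikeDegree

variable {ι : Type*} {len : ι → ℕ}

theorem sigma_fin_eq_mk_iff {x : Σ i, Fin (len i)} {i : ι} {j : Fin (len i)} :
    x = ⟨i, j⟩ ↔ x.1 = i ∧ x.2.val = j.val := by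
  obtain ⟨i', j'⟩ := x
  constructor
  · intro h
    cases h
    exact ⟨rfl, rfl⟩
  · rintro ⟨rfl, h⟩
    exact congrArg _ (Fin.ext h)

theorem exists_starlikeRel_some_iff (i : ι) (j : Fin (len i)) :
    ∃ a, ∀ x, starlikeRel len x (some ⟨i, j⟩) ↔ x = a := by
  obtain ⟨_ | j, hj⟩ := j
  · exact ⟨none, by rintro (_ | x) <;> simp [starlikeRel]⟩
  · refine ⟨some ⟨i, j, by omega⟩, ?_⟩
    rintro (_ | x) <;> simp [starlikeRel, sigma_fin_eq_mk_iff]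

theorem starlikeRel_some_iff_exists {i : ι} {j : Fin (len i)} {x : Option (Σ i, Fin (len i))} :
    starlikeRel len (some ⟨i, j⟩) x ↔ ∃ h : j + 1 < len i, x = some ⟨i, j + 1, h⟩ := by
  rcases x with _ | x
  · simp [starlikeRel]
  · simp only [starlikeRel, Option.some_inj, sigma_fin_eq_mk_iff, exists_prop]
    constructor
    · rintro ⟨rfl, h⟩
      exact ⟨h ▸ x.2.2, rfl, h.symm⟩
    · rintro ⟨-, rfl, h⟩
      exact ⟨rfl, h.symm⟩

variable [Fintype ι] [DecidableRel (starlike len).Adj]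

theorem degree_starlike_none (hlen : ∀ i, 1 ≤ len i) :
    (starlike len).degree none = Fintype.card ι := by
  classical
  let f (i : ι) : Option (Σ i, Fin (len i)) := some ⟨i, 0, hlen i⟩
  have hf : Function.Injective f := fun i j h => congrArg Sigma.fst (Option.some_injective _ h)
  have himage : (starlike len).neighborFinset none = Finset.univ.image f := by
    ext (_ | x) <;> simp [starlike_adj, starlikeRel, f, eq_comm, sigma_fin_eq_mk_iff]
  rw [← card_neighborFinset_eq_degree, himage, Finset.card_image_of_injective _ hf,
    Finset.card_univ]

theorem degree_starlike_some (i : ι) (j : Fin (len i)) :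
    (starlike len).degree (some ⟨i, j⟩) = if j + 1 < len i then 2 else 1 := by
  classical
  obtain ⟨a, ha⟩ := exists_starlikeRel_some_iff i j
  rw [← card_neighborFinset_eq_degree]
  split_ifs with hj
  · refine Finset.card_eq_two.2 ⟨a, some ⟨i, j + 1, hj⟩, ?_, ?_⟩
    · rintro rfl
      have := (ha _).2 rfl
      simp [starlikeRel] at this
      omega
    · ext x
      simp [starlike_adj, ha, starlikeRel_some_iff_exists, hj, or_comm]
  · refine Finset.card_eq_one.2 ⟨a, ?_⟩
    ext x
    simp [starlike_adj, ha, starlikeRel_some_iff_exists, hj]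

theorem sum_degree_starlike (hlen : ∀ i, 1 ≤ len i) (f : ℝ → ℝ) :
    ∑ x, f ((starlike len).degree x)
      = f (Fintype.card ι) + (∑ i, (len i - 1) : ℕ) * f 2 + Fintype.card ι * f 1 := by
  have hleg (i : ι) : ∑ j : Fin (len i), f ((starlike len).degree (some ⟨i, j⟩))
      = (len i - 1 : ℕ) * f 2 + f 1 := by
    simp only [degree_starlike_some]
    obtain ⟨m, hm⟩ := Nat.exists_eq_add_of_le' (hlen i)
    rw [hm, Fin.sum_univ_castSucc]
    simp
  rw [Fintype.sum_option, degree_starlike_none hlen, Fintype.sum_sigma,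
    Finset.sum_congr rfl fun i _ => hleg i, Finset.sum_add_distrib, ← Finset.sum_mul,
    Finset.sum_const, Finset.card_univ, nsmul_eq_mul, Nat.cast_sum, add_assoc]

end StarlikeDegree

section ZagrebTree

variable {n k s : ℕ}

theorem one_le_zagrebLegs (hk : 1 ≤ k) (i : Fin 1 ⊕ Fin (s - 1) ⊕ Fin (n - (k + 1) * s)) :
    1 ≤ zagrebLegs n k s i := by
  rcases i with _ | _ | _ <;> simp [zagrebLegs, hk]

theorem sum_zagrebLegs_sub_one (hk : 1 ≤ k) (hs : 1 ≤ s) :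
    ∑ i, (zagrebLegs n k s i - 1) + 1 = k * s := by
  obtain ⟨s, rfl⟩ := Nat.exists_eq_add_of_le' hs
  simp only [Fintype.sum_sum_type, zagrebLegs, Finset.sum_const, Finset.card_univ,
    Fintype.card_fin, smul_eq_mul, Nat.add_sub_cancel, mul_add, mul_one, mul_comm s k]
  omega

theorem card_add_mul_eq_of_le (hs : 1 ≤ s) (hn : (k + 1) * s ≤ n) :
    Fintype.card (Fin 1 ⊕ Fin (s - 1) ⊕ Fin (n - (k + 1) * s)) + k * s = n := by
  simp only [Fintype.card_sum, Fintype.card_fin]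
  rw [add_mul, one_mul] at hn ⊢
  omega

theorem sum_degree_zagrebTree (hk : 1 ≤ k) (hs : 1 ≤ s) (hn : (k + 1) * s ≤ n)
    [DecidableRel (zagrebTree n k s).Adj] (f : ℝ → ℝ) :
    ∑ x, f ((zagrebTree n k s).degree x) = extremalDegreeSum f n (k * s : ℕ) := by
  have hcard : (Fintype.card (Fin 1 ⊕ Fin (s - 1) ⊕ Fin (n - (k + 1) * s)) : ℝ)
      = n - (k * s : ℕ) :=
    eq_sub_of_add_eq (mod_cast card_add_mul_eq_of_le hs hn)
  have hsum : ((∑ i, (zagrebLegs n k s i - 1) : ℕ) : ℝ) = (k * s : ℕ) - 1 :=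
    eq_sub_of_add_eq (mod_cast sum_zagrebLegs_sub_one hk hs)
  rw [extremalDegreeSum, ← hcard, ← hsum]
  let : DecidableRel (starlike (zagrebLegs n k s)).Adj := ‹DecidableRel (zagrebTree n k s).Adj›
  exact sum_degree_starlike (one_le_zagrebLegs hk) f

end ZagrebTree

section Extremal

variable {V : Type*} [Fintype V] {T : SimpleGraph V} [DecidableRel T.Adj] {k s : ℕ}

theorem exists_mem_nonLeaves_forall_degree_le_two (hne : (nonLeaves T).Nonempty)
    (hbranch : {v | 3 ≤ T.degree v}.Subsingleton) :
    ∃ c ∈ nonLeaves T, ∀ v ≠ c, T.degree v ≤ 2 := by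
  by_cases! h : ∃ c, 3 ≤ T.degree c
  · obtain ⟨c, hc⟩ := h
    exact ⟨c, mem_nonLeaves.2 (by omega), fun v hv =>
      Nat.le_of_lt_succ (lt_of_not_ge fun hv₃ => hv (hbranch hv₃ hc))⟩
  · exact hne.imp fun c hc => ⟨hc, fun v _ => Nat.le_of_lt_succ (h v)⟩

theorem degree_add_card_nonLeaves [Nontrivial V] (hT : T.IsTree) {c : V} (hc : c ∈ nonLeaves T)
    (hdeg : ∀ v ≠ c, T.degree v ≤ 2) :
    T.degree c + (nonLeaves T).card = Fintype.card V := by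
  classical
  have hinner : ∑ v ∈ (nonLeaves T).erase c, T.degree v = ((nonLeaves T).card - 1) * 2 := by
    rw [← Finset.card_erase_of_mem hc]
    refine Finset.sum_const_nat fun v hv => ?_
    obtain ⟨hvc, hv⟩ := Finset.mem_erase.1 hv
    exact (hdeg v hvc).antisymm (mem_nonLeaves.1 hv)
  have houter : ∑ v ∈ (nonLeaves T)ᶜ, T.degree v = (nonLeaves T)ᶜ.card * 1 :=
    Finset.sum_const_nat fun v hv =>
      degree_eq_one_of_notMem_nonLeaves hT.connected (Finset.mem_compl.1 hv)
  have hsum := sum_degree_add_two hT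
  have hpos := Finset.card_pos.2 ⟨c, hc⟩
  have hcompl := Finset.card_add_card_compl (nonLeaves T)
  rw [← Finset.sum_add_sum_compl (nonLeaves T), ← Finset.add_sum_erase _ _ hc, hinner,
    houter] at hsum
  omega

theorem nonempty_iso_zagrebTree (hT : T.IsTree) (hk : 1 ≤ k) (hs : 3 ≤ s)
    (hγ : T.distDominationNumber k = s) (hcard : (nonLeaves T).card = k * s)
    (hbranch : {v | 3 ≤ T.degree v}.Subsingleton) :
    Nonempty (T ≃g zagrebTree (Fintype.card V) k s) := by
  have hγ₂ : 2 ≤ T.distDominationNumber k := by omega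
  have := nontrivial_of_two_le_distDominationNumber hT.connected hγ₂
  have hne : (nonLeaves T).Nonempty := Finset.card_pos.1 (hcard ▸ Nat.mul_pos hk (by omega))
  obtain ⟨c, hc, hdeg⟩ := exists_mem_nonLeaves_forall_degree_le_two hne hbranch
  have hdegc := degree_add_card_nonLeaves hT hc hdeg
  rw [hcard, ← card_neighborSet_eq_degree] at hdegc
  obtain ⟨len, hlen, ⟨e⟩⟩ := exists_iso_starlike hT c hdeg
  have hV : Fintype.card V = ∑ i, len i + 1 := by
    simp [Fintype.card_congr e.toEquiv]
  have hsub : ∑ i, (len i - 1) + Fintype.card (T.neighborSet c) = ∑ i, len i := by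
    rw [← Finset.card_univ, Finset.card_eq_sum_ones, ← Finset.sum_add_distrib]
    exact Finset.sum_congr rfl fun i _ => Nat.sub_add_cancel (hlen i)
  obtain ⟨i₀, L, hi₀, hL, hleg₀, hlegL, hleg⟩ := exists_legs_of_le_distDominationNumber_starlike
    hlen hk hs (hγ.symm.trans (distDominationNumber_congr e k)).le (by omega)
  have hn : (k + 1) * s ≤ Fintype.card V :=
    hγ ▸ mul_distDominationNumber_le_card hT.connected hγ₂
  obtain ⟨e'⟩ := nonempty_starlike_iso_zagrebTree hn (by omega) hi₀ hL hleg₀ hlegL hleg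
  exact ⟨e.trans e'⟩

variable {f : ℝ → ℝ}

theorem sum_degree_le_of_distDominationNumber (hT : T.IsTree) (hf : ConvexOn ℝ (Set.Ici 1) f)
    (hk : 1 ≤ k) (hγ : 2 ≤ T.distDominationNumber k) :
    ∑ v, f (T.degree v)
      ≤ extremalDegreeSum f (Fintype.card V) (k * T.distDominationNumber k) := by
  have := nontrivial_of_two_le_distDominationNumber hT.connected hγ
  obtain ⟨S, hS, hcard⟩ := Finset.exists_subset_card_eq
    (mul_distDominationNumber_le_card_nonLeaves hT.connected hk hγ)
  exact hcard ▸ sum_degree_le_extremalDegreeSum hT hf hS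

theorem sum_degree_eq_iff_nonempty_iso_zagrebTree (hT : T.IsTree)
    (hf : StrictConvexOn ℝ (Set.Ici 1) f) (hk : 1 ≤ k) (hγ : 3 ≤ T.distDominationNumber k) :
    ∑ v, f (T.degree v) = extremalDegreeSum f (Fintype.card V) (k * T.distDominationNumber k) ↔
      Nonempty (T ≃g zagrebTree (Fintype.card V) k (T.distDominationNumber k)) := by
  classical
  have hγ₂ : 2 ≤ T.distDominationNumber k := by omega
  have := nontrivial_of_two_le_distDominationNumber hT.connected hγ₂
  constructor
  · obtain ⟨S, hS, hcard⟩ := Finset.exists_subset_card_eq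
      (mul_distDominationNumber_le_card_nonLeaves hT.connected hk hγ₂)
    intro heq
    rw [← hcard] at heq
    obtain rfl := nonLeaves_eq_of_sum_degree_eq hT hf hS heq
    exact nonempty_iso_zagrebTree hT hk hγ rfl hcard (subsingleton_of_sum_degree_eq hT hf heq)
  · rintro ⟨e⟩
    rw [← sum_degree_zagrebTree hk (by omega) (mul_distDominationNumber_le_card hT.connected hγ₂)]
    exact Fintype.sum_equiv e.toEquiv _ _ fun v => congrArg (fun d : ℕ => f d) (e.degree_eq v).symm

end Extremal

section Zagreb

variable {V : Type*} [Fintype V] {G : SimpleGraph V} [DecidableRel G.Adj] {k : ℕ}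

theorem zagrebPiTwo_eq_prod_pow [DecidableEq V] :
    G.zagrebPiTwo = ∏ v, G.degree v ^ G.degree v := by
  have hedge : ∀ e ∈ G.edgeFinset, (e.map fun v => G.degree v).mul
      = ∏ v with v ∈ e, G.degree v := by
    intro e he
    induction e with
    | _ u v =>
      have huv : u ≠ v := (mem_edgeFinset.1 he : G.Adj u v).ne
      have hends : ({w | w ∈ s(u, v)} : Finset V) = {u, v} := by ext; simp
      rw [hends, Finset.prod_pair huv]
      rfl
  rw [zagrebPiTwo, Finset.prod_congr rfl hedge,
    Finset.prod_comm' (t' := Finset.univ) (s' := fun v => G.incidenceFinset v)]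
  · simp
  · simp [mem_incidenceFinset, incidenceSet]

variable [Nontrivial V]

theorem zagrebPiOne_pos (hG : G.Connected) : 0 < G.zagrebPiOne :=
  Finset.prod_pos fun v _ => pow_pos (hG.preconnected.degree_pos_of_nontrivial v) 2

theorem zagrebPiTwo_pos [DecidableEq V] (hG : G.Connected) : 0 < G.zagrebPiTwo := by
  rw [zagrebPiTwo_eq_prod_pow]
  exact Finset.prod_pos fun v _ => pow_pos (hG.preconnected.degree_pos_of_nontrivial v) _

theorem log_zagrebPiOne (hG : G.Connected) :
    Real.log G.zagrebPiOne = -2 * ∑ v, -Real.log (G.degree v) := by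
  rw [zagrebPiOne, Nat.cast_prod, Real.log_prod, Finset.mul_sum]
  · exact Finset.sum_congr rfl fun v _ => by rw [Nat.cast_pow, Real.log_pow]; simp
  · exact fun v _ => mod_cast (pow_pos (hG.preconnected.degree_pos_of_nontrivial v) 2).ne'

theorem log_zagrebPiTwo [DecidableEq V] (hG : G.Connected) :
    Real.log G.zagrebPiTwo = ∑ v, G.degree v * Real.log (G.degree v) := by
  rw [zagrebPiTwo_eq_prod_pow, Nat.cast_prod, Real.log_prod]
  · exact Finset.sum_congr rfl fun v _ => by rw [Nat.cast_pow, Real.log_pow]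
  · exact fun v _ => mod_cast (pow_pos (hG.preconnected.degree_pos_of_nontrivial v) _).ne'

end Zagreb

section Bounds

theorem log_four_pow_mul_pow {m d : ℕ} (hm : 1 ≤ m) (hd : 0 < d) (e : ℕ) :
    Real.log (4 ^ (m - 1) * d ^ e : ℕ) = 2 * (m - 1) * Real.log 2 + e * Real.log d := by
  have hfour : Real.log 4 = 2 * Real.log 2 := by
    rw [show (4 : ℝ) = 2 ^ 2 by norm_num, Real.log_pow, Nat.cast_ofNat]
  push_cast
  rw [Real.log_mul (by positivity) (by positivity), Real.log_pow, Real.log_pow, hfour,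
    Nat.cast_pred hm]
  ring

theorem log_four_pow_mul_sq {n m : ℕ} (hm : 1 ≤ m) (hmn : m < n) :
    Real.log (4 ^ (m - 1) * (n - m) ^ 2 : ℕ)
      = -2 * extremalDegreeSum (fun x => -Real.log x) n m := by
  rw [log_four_pow_mul_pow hm (Nat.sub_pos_of_lt hmn), extremalDegreeSum, Nat.cast_sub hmn.le]
  simp only [Real.log_one]
  push_cast
  ring

theorem log_four_pow_mul_pow_self {n m : ℕ} (hm : 1 ≤ m) (hmn : m < n) :
    Real.log (4 ^ (m - 1) * (n - m) ^ (n - m) : ℕ)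
      = extremalDegreeSum (fun x => x * Real.log x) n m := by
  rw [log_four_pow_mul_pow hm (Nat.sub_pos_of_lt hmn), extremalDegreeSum, Nat.cast_sub hmn.le]
  simp only [Real.log_one]
  ring

theorem log_natCast_le_log_natCast_iff {a b : ℕ} (ha : 0 < a) (hb : 0 < b) :
    Real.log a ≤ Real.log b ↔ a ≤ b := by
  rw [Real.log_le_log_iff (mod_cast ha) (mod_cast hb), Nat.cast_le]

theorem log_natCast_eq_log_natCast_iff {a b : ℕ} (ha : 0 < a) (hb : 0 < b) :
    Real.log a = Real.log b ↔ a = b := by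
  rw [Real.log_injOn_pos.eq_iff (Set.mem_Ioi.2 (mod_cast ha)) (Set.mem_Ioi.2 (mod_cast hb)),
    Nat.cast_inj]

theorem strictConvexOn_neg_log : StrictConvexOn ℝ (Set.Ici 1) fun x => -Real.log x :=
  (strictConcaveOn_log_Ioi.subset (Set.Ici_subset_Ioi.2 one_pos) (convex_Ici 1)).neg

theorem strictConvexOn_mul_log : StrictConvexOn ℝ (Set.Ici 1) fun x => x * Real.log x :=
  Real.strictConvexOn_mul_log.subset (Set.Ici_subset_Ici.2 zero_le_one) (convex_Ici 1)

variable {V : Type*} [Fintype V] {T : SimpleGraph V} {k : ℕ}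

theorem mul_distDominationNumber_lt_card (hT : T.Connected) (hγ : 2 ≤ T.distDominationNumber k) :
    k * T.distDominationNumber k < Fintype.card V :=
  (Nat.mul_lt_mul_of_pos_right k.lt_succ_self (by omega)).trans_le
    (mul_distDominationNumber_le_card hT hγ)

variable [DecidableRel T.Adj]

theorem le_zagrebPiOne (hT : T.IsTree) (hk : 1 ≤ k) (hγ : 2 ≤ T.distDominationNumber k) :
    4 ^ (k * T.distDominationNumber k - 1)
      * (Fintype.card V - k * T.distDominationNumber k) ^ 2 ≤ T.zagrebPiOne := by
  have hlt := mul_distDominationNumber_lt_card hT.connected hγ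
  have := nontrivial_of_two_le_distDominationNumber hT.connected hγ
  have hsum := sum_degree_le_of_distDominationNumber hT strictConvexOn_neg_log.convexOn hk hγ
  have hpos := Nat.sub_pos_of_lt hlt
  rw [← log_natCast_le_log_natCast_iff (by positivity) (zagrebPiOne_pos hT.connected),
    log_four_pow_mul_sq (Nat.mul_pos hk (by omega)) hlt, log_zagrebPiOne hT.connected]
  exact mul_le_mul_of_nonpos_left hsum (by norm_num)

theorem zagrebPiOne_eq_iff (hT : T.IsTree) (hk : 1 ≤ k) (hγ : 3 ≤ T.distDominationNumber k) :
    T.zagrebPiOne = 4 ^ (k * T.distDominationNumber k - 1)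
      * (Fintype.card V - k * T.distDominationNumber k) ^ 2 ↔
      Nonempty (T ≃g zagrebTree (Fintype.card V) k (T.distDominationNumber k)) := by
  have hγ₂ : 2 ≤ T.distDominationNumber k := by omega
  have hlt := mul_distDominationNumber_lt_card hT.connected hγ₂
  have := nontrivial_of_two_le_distDominationNumber hT.connected hγ₂
  have hpos := Nat.sub_pos_of_lt hlt
  rw [← log_natCast_eq_log_natCast_iff (zagrebPiOne_pos hT.connected) (by positivity),
    log_four_pow_mul_sq (Nat.mul_pos hk (by omega)) hlt, log_zagrebPiOne hT.connected,
    mul_right_inj' (by norm_num),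
    sum_degree_eq_iff_nonempty_iso_zagrebTree hT strictConvexOn_neg_log hk hγ]

variable [DecidableEq V]

theorem zagrebPiTwo_le (hT : T.IsTree) (hk : 1 ≤ k) (hγ : 2 ≤ T.distDominationNumber k) :
    T.zagrebPiTwo ≤ 4 ^ (k * T.distDominationNumber k - 1)
      * (Fintype.card V - k * T.distDominationNumber k)
        ^ (Fintype.card V - k * T.distDominationNumber k) := by
  have hlt := mul_distDominationNumber_lt_card hT.connected hγ
  have := nontrivial_of_two_le_distDominationNumber hT.connected hγ
  have hpos := Nat.sub_pos_of_lt hlt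
  rw [← log_natCast_le_log_natCast_iff (zagrebPiTwo_pos hT.connected) (by positivity),
    log_four_pow_mul_pow_self (Nat.mul_pos hk (by omega)) hlt, log_zagrebPiTwo hT.connected]
  exact sum_degree_le_of_distDominationNumber hT strictConvexOn_mul_log.convexOn hk hγ

theorem zagrebPiTwo_eq_iff (hT : T.IsTree) (hk : 1 ≤ k) (hγ : 3 ≤ T.distDominationNumber k) :
    T.zagrebPiTwo = 4 ^ (k * T.distDominationNumber k - 1)
      * (Fintype.card V - k * T.distDominationNumber k)
        ^ (Fintype.card V - k * T.distDominationNumber k) ↔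
      Nonempty (T ≃g zagrebTree (Fintype.card V) k (T.distDominationNumber k)) := by
  have hγ₂ : 2 ≤ T.distDominationNumber k := by omega
  have hlt := mul_distDominationNumber_lt_card hT.connected hγ₂
  have := nontrivial_of_two_le_distDominationNumber hT.connected hγ₂
  have hpos := Nat.sub_pos_of_lt hlt
  rw [← log_natCast_eq_log_natCast_iff (zagrebPiTwo_pos hT.connected) (by positivity),
    log_four_pow_mul_pow_self (Nat.mul_pos hk (by omega)) hlt, log_zagrebPiTwo hT.connected,
    sum_degree_eq_iff_nonempty_iso_zagrebTree hT strictConvexOn_mul_log hk hγ]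

end Bounds

end ZagrebIndex

theorem mainTheorem3 {V : Type*} [Fintype V] [DecidableEq V] (T : SimpleGraph V)
    [DecidableRel T.Adj] (hT : T.IsTree) (n k γ : ℕ) (hk : 1 ≤ k)
    (hn : Fintype.card V = n) (hγ : T.distDominationNumber k = γ) (hγ3 : 3 ≤ γ) :
    (k + 1) * γ ≤ n ∧
    4 ^ (k * γ - 1) * (n - k * γ) ^ 2 ≤ T.zagrebPiOne ∧
    T.zagrebPiTwo ≤ 4 ^ (k * γ - 1) * (n - k * γ) ^ (n - k * γ) ∧
    (T.zagrebPiOne = 4 ^ (k * γ - 1) * (n - k * γ) ^ 2 ↔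
      Nonempty (T ≃g SimpleGraph.zagrebTree n k γ)) ∧
    (T.zagrebPiTwo = 4 ^ (k * γ - 1) * (n - k * γ) ^ (n - k * γ) ↔
      Nonempty (T ≃g SimpleGraph.zagrebTree n k γ)) := by
  subst hn hγ
  have hγ₂ : 2 ≤ T.distDominationNumber k := by omega
  exact ⟨ZagrebIndex.mul_distDominationNumber_le_card hT.connected hγ₂,
    ZagrebIndex.le_zagrebPiOne hT hk hγ₂, ZagrebIndex.zagrebPiTwo_le hT hk hγ₂,
    ZagrebIndex.zagrebPiOne_eq_iff hT hk hγ3, ZagrebIndex.zagrebPiTwo_eq_iff hT hk hγ3⟩
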